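/- Let $n,N,k$ be integers with $k\ge 1$ and $2k\le N$, and let $C=\{q_1,\dots,q_N\}$ be a set of $N$ distinct points of the unit sphere $S^{n-1}\subseteq\mathbb{R}^n$. A Kostlan–Shub–Smale polynomial of degree $d$ is a random polynomial $P(x)=\sum_{|\alpha|\le d}A_\alpha x^\alpha$ in $n$ variables whose coefficients $A_\alpha$ are independent normal random variables with mean zero and variance $\binom{d}{\alpha}/2^d$, where $\binom{d}{\alpha}=\frac{d!}{(d-|\alpha|)!\prod_i\alpha_i!}$. For $m\ge 1$ let $P_1,\dots,P_m$ be an independent sample of such polynomials, put $f_i:=P_i/\sqrt m$, and let $\Phi$ be the random $m\times N$ matrix $\Phi_{ij}:=f_i(q_j)$. For a finite (possibly signed) measure $\nu$ of finite support on $S^{n-1}$ let $b_\nu\in\mathbb{R}^m$ be its vector of moments $(b_\nu)_i=\int f_i\,d\nu$. For $0<\eta<1$ let \[c_0(\eta):=\min\left(\tfrac12\log\tfrac{1}{1+\eta}+\tfrac{\eta}{2},\ \tfrac12\log\tfrac{1}{1-\eta}-\tfrac{\eta}{2}\right).\] There is an absolute constant $B_1$ such that for all $n,N,k,C$ as above there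 is $d_0$ (depending only on these data) such that for all $d\ge d_0$ and all $m\ge1$, with probability at least \[1-\binom{N}{2k}\left(\frac{30}{\sqrt2-1}\right)^{2k}2e^{-m\,c_0\left(\frac{\sqrt2-1}{6}\right)}\] both of the following recovery guarantees hold (that is, the probability of failure of at least one of them is at most the subtracted quantity), simultaneously for all measures $\mu=\sum_{i=1}^k g_i\delta_{y_i}$ with $g_i\ge 0$ and $y_i\in S^{n-1}$: 1. (Exact recovery) If $\operatorname{supp}(\mu)\subseteq C$ and $c^*\in\mathbb{R}^N$ is a minimizer of $\|c\|_1$ subject to $\Phi c=b_\mu$, then $\mu=\sum_{j=1}^N c^*_j\delta_{q_j}$. 2. (Approximate recovery) If $\tau\in\mathbb{R}$, if $c_\nu\in\mathbb{R}^N$ has at most $k$ nonzero components, if $\nu=\sum_{j=1}^N(c_\nu)_j\delta_{q_j}$ satisfies $\|b_\mu-b_\nu\|_2\le\tau$, and if $c^*\in\mathbb{R}^N$ is a minimizer of $\|c\|_1$ subject to $\|\Phi c-b_\mu\|_2\le\tau$, then $\|c^*-c_\nu\|_2\le B_1\tau$. -/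

import Mathlib

open MeasureTheory ProbabilityTheory
open scoped NNReal Nat

namespace KSSRecovery

/-- The unit sphere `S^{n-1}` in `ℝⁿ`. -/
abbrev Sph (n : ℕ) : Type := Metric.sphere (0 : EuclideanSpace ℝ (Fin n)) 1

/-- Multi-indices `α` with `n` parts and degree `|α| ≤ d` (each part is then at most `d`). -/
abbrev MultiIndex (n d : ℕ) : Type := {α : Fin n → Fin (d + 1) // ∑ j, (α j : ℕ) ≤ d}

/-- The degree `|α|`. -/
def MultiIndex.deg {n d : ℕ} (α : MultiIndex n d) : ℕ := ∑ j, (α.1 j : ℕ)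

/-- The variance `binom(d, α) / 2 ^ d`, where
`binom(d, α) = d! / ((d - |α|)! * ∏ j, (α j)!)`. -/
noncomputable def kssVar {n d : ℕ} (α : MultiIndex n d) : ℝ≥0 :=
  ((d ! : ℝ≥0) / (((d - α.deg)! : ℝ≥0) * ∏ j, ((α.1 j : ℕ)! : ℝ≥0))) / 2 ^ d

/-- The polynomial `∑_{|α| ≤ d} a_α x^α`, as a function on the sphere. -/
def polyEval {n d : ℕ} (a : MultiIndex n d → ℝ) (x : Sph n) : ℝ :=
  ∑ α : MultiIndex n d, a α * ∏ j, (x : EuclideanSpace ℝ (Fin n)) j ^ (α.1 j : ℕ)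

/-- `A i α` are the coefficients of an independent sample of `m` Kostlan–Shub–Smale polynomials of
degree `d` in `n` variables: they are independent over all pairs `(i, α)`, and `A i α` is a centred
normal variable of variance `binom(d, α) / 2 ^ d`. -/
structure IsKSSSample {Ω : Type*} [MeasurableSpace Ω] (P : Measure Ω) {n d m : ℕ}
    (A : Fin m → MultiIndex n d → Ω → ℝ) : Prop where
  law : ∀ i α, HasLaw (A i α) (gaussianReal 0 (kssVar α)) P
  indep : iIndepFun (fun p : Fin m × MultiIndex n d => A p.1 p.2) P

/-- The random functions `P_i / √m`, for polynomials `P_i` with coefficients `A i · ω`. -/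
noncomputable def kssFun {Ω : Type*} {n d m : ℕ} (A : Fin m → MultiIndex n d → Ω → ℝ) (ω : Ω) :
    Fin m → Sph n → ℝ :=
  fun i x => polyEval (fun α => A i α ω) x / √(m : ℝ)

/-- The measurement matrix `M i j = f_i (q_j)`. For `f = kssFun A ω` it is the random matrix `Φ`. -/
def measMatrix {n m N : ℕ} (f : Fin m → Sph n → ℝ) (q : Fin N → Sph n) :
    Matrix (Fin m) (Fin N) ℝ :=
  Matrix.of fun i j => f i (q j)

/-- The product `M c`, as a vector of Euclidean space. -/
noncomputable def matApply {m N : ℕ} (M : Matrix (Fin m) (Fin N) ℝ)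
    (c : EuclideanSpace ℝ (Fin N)) : EuclideanSpace ℝ (Fin m) :=
  WithLp.toLp 2 (M.mulVec c.ofLp)

/-- `μ` is a point measure `∑_{i=1}^k g_i δ_{y_i}` on the sphere, with coefficients `g_i ≥ 0`. -/
def IsPointMeasure {n : ℕ} (k : ℕ) (μ : Measure (Sph n)) : Prop :=
  ∃ (g : Fin k → ℝ≥0) (y : Fin k → Sph n), μ = ∑ i, g i • Measure.dirac (y i)

/-- The vector `b_μ` of moments of the measure `μ` with respect to the functions `f_i`. -/
noncomputable def moments {n m : ℕ} (f : Fin m → Sph n → ℝ) (μ : Measure (Sph n)) :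
    EuclideanSpace ℝ (Fin m) :=
  WithLp.toLp 2 fun i => ∫ x, f i x ∂μ

/-- The vector `b_ν` of moments of the (possibly signed) measure `ν = ∑ j, c_j δ_{q_j}`. -/
noncomputable def gridMoments {n m N : ℕ} (f : Fin m → Sph n → ℝ) (q : Fin N → Sph n)
    (c : EuclideanSpace ℝ (Fin N)) : EuclideanSpace ℝ (Fin m) :=
  WithLp.toLp 2 fun i => ∑ j, c j * f i (q j)

/-- The norm `‖c‖₁`. -/
def l1 {N : ℕ} (c : EuclideanSpace ℝ (Fin N)) : ℝ := ∑ j, |c j|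

/-- `c` is a minimizer of `‖·‖₁` on the feasible set `F`. -/
def IsL1Minimizer {N : ℕ} (F : Set (EuclideanSpace ℝ (Fin N)))
    (c : EuclideanSpace ℝ (Fin N)) : Prop :=
  c ∈ F ∧ IsMinOn l1 F c

/-- `c` has at most `s` nonzero components. -/
def IsSparse {N : ℕ} (s : ℕ) (c : EuclideanSpace ℝ (Fin N)) : Prop :=
  {j | c j ≠ 0}.ncard ≤ s

/-- Exact recovery: for every point measure `μ` with `k` atoms and support in the grid, each
minimizer `c` of `‖c‖₁` subject to `M c = b_μ` satisfies `μ = ∑ j, c_j δ_{q_j}`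
(in particular its coefficients are nonnegative). -/
def ExactRecovery {n m N : ℕ} (k : ℕ) (f : Fin m → Sph n → ℝ) (q : Fin N → Sph n) : Prop :=
  ∀ μ : Measure (Sph n), IsPointMeasure k μ → μ.support ⊆ Set.range q →
    ∀ c : EuclideanSpace ℝ (Fin N),
      IsL1Minimizer {z | matApply (measMatrix f q) z = moments f μ} c →
        (∀ j, 0 ≤ c j) ∧ μ = ∑ j, ENNReal.ofReal (c j) • Measure.dirac (q j)

/-- Approximate recovery with constant `B`: for every point measure `μ` with `k` atoms anywhere on
the sphere, every `τ`, and every `ν = ∑ j, (c_ν)_j δ_{q_j}` with `c_ν` `k`-sparse and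
`‖b_μ - b_ν‖₂ ≤ τ`, each minimizer `c` of `‖c‖₁` subject to `‖M c - b_μ‖₂ ≤ τ` satisfies
`‖c - c_ν‖₂ ≤ B τ`. -/
def ApproxRecovery {n m N : ℕ} (k : ℕ) (B : ℝ) (f : Fin m → Sph n → ℝ) (q : Fin N → Sph n) :
    Prop :=
  ∀ μ : Measure (Sph n), IsPointMeasure k μ →
    ∀ (τ : ℝ) (cν : EuclideanSpace ℝ (Fin N)), IsSparse k cν →
      ‖moments f μ - gridMoments f q cν‖ ≤ τ →
        ∀ c : EuclideanSpace ℝ (Fin N),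
          IsL1Minimizer {z | ‖matApply (measMatrix f q) z - moments f μ‖ ≤ τ} c →
            ‖c - cν‖ ≤ B * τ

/-- The rate function `c₀(η)`, for `0 < η < 1`. -/
noncomputable def c₀ (η : ℝ) : ℝ :=
  min (1 / 2 * Real.log (1 / (1 + η)) + η / 2) (1 / 2 * Real.log (1 / (1 - η)) - η / 2)

end KSSRecovery

/-! For unit vectors `x ≠ y`, the values of a Kostlan–Shub–Smale polynomial have covariance `((1 +
⟪x, y⟫) / 2) ^ d`, which tends to 0, and the variance is 1 at every point of the sphere. So for
large `d` the values on the grid are nearly independent standard normals, and each row of `Φ`, up to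
the factor `1 / √m`, has a covariance matrix close to the identity. For a fixed `v ≠ 0`, `m ‖Φ v‖ ^
2` is then a sum of `m` squares of independent centred normals of variance `Q v ≈ ‖v‖ ^ 2`, and a
Chernoff bound gives the rate `c₀` (`measureReal_deviation_le`).

To control all `2k`-sparse vectors at once, each of the `N.choose (2 * k)` coordinate subspaces of
dimension `2k` receives a `1/4`-net of at most `9 ^ (2 * k)` points, fixed before the random draw.
Near-isometry on the nets forces the restricted isometry property (RIP) with constant `1/4`
(`abs_norm_sq_map_sub_le_of_net`); the union bound costs less than the stated probability because `9
≤ 30 / (√2 - 1)`.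

The rest is deterministic. RIP makes `ℓ¹` minimization stable (`HasRIP.norm_sub_le`), which is
approximate recovery; exact recovery is its case `τ = 0`. -/

namespace KSSRecovery

/-! ### Stable sparse recovery from the restricted isometry property. -/

section SparseRecovery

open Finset

/-- The coordinate restriction of `v` to the index set `S`. -/
noncomputable def restr {N : ℕ} (S : Finset (Fin N)) (v : EuclideanSpace ℝ (Fin N)) :
    EuclideanSpace ℝ (Fin N) :=
  WithLp.toLp 2 fun j => if j ∈ S then v j else 0

/-- The restricted isometry property of order `s` with constant `δ`. -/
def HasRIP {N : ℕ} {F : Type*} [NormedAddCommGroup F] [InnerProductSpace ℝ F]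
    (L : EuclideanSpace ℝ (Fin N) →ₗ[ℝ] F) (s : ℕ) (δ : ℝ) : Prop :=
  ∀ v, IsSparse s v → |‖L v‖ ^ 2 - ‖v‖ ^ 2| ≤ δ * ‖v‖ ^ 2

lemma norm_sq_smul_add_smul {E : Type*} [NormedAddCommGroup E] [InnerProductSpace ℝ E] (x y : E)
    (a b : ℝ) :
    ‖a • x + b • y‖ ^ 2 = a ^ 2 * ‖x‖ ^ 2 + 2 * a * b * inner ℝ x y + b ^ 2 * ‖y‖ ^ 2 := by
  rw [norm_add_sq_real, real_inner_smul_left, real_inner_smul_right, norm_smul, norm_smul, mul_pow,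
    mul_pow, Real.norm_eq_abs, Real.norm_eq_abs, sq_abs, sq_abs]
  ring

/-- A quadratic bound on `‖L w‖ ^ 2 - ‖w‖ ^ 2` on the span of `u`, `v` polarizes. -/
lemma abs_inner_map_sub_inner_le {E F : Type*} [NormedAddCommGroup E] [InnerProductSpace ℝ E]
    [NormedAddCommGroup F] [InnerProductSpace ℝ F] (L : E →ₗ[ℝ] F) {δ : ℝ} (u v : E)
    (h : ∀ a b : ℝ, |‖L (a • u + b • v)‖ ^ 2 - ‖a • u + b • v‖ ^ 2| ≤ δ * ‖a • u + b • v‖ ^ 2) :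
    |inner ℝ (L u) (L v) - inner ℝ u v| ≤ δ * ‖u‖ * ‖v‖ := by
  rcases eq_or_ne u 0 with rfl | hu
  · simp
  rcases eq_or_ne v 0 with rfl | hv
  · simp
  have hu' : 0 < ‖u‖ := norm_pos_iff.2 hu
  have hv' : 0 < ‖v‖ := norm_pos_iff.2 hv
  -- These weights give both summands the norm `‖u‖ * ‖v‖`. In the difference of the two bounds the
  -- square terms cancel on the left and the inner products on the right.
  have h1 := h ‖v‖ ‖u‖
  have h2 := h ‖v‖ (-‖u‖)
  rw [map_add, map_smul, map_smul, norm_sq_smul_add_smul, norm_sq_smul_add_smul] at h1 h2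
  have hp : 0 < ‖u‖ * ‖v‖ := mul_pos hu' hv'
  have h1' := abs_le.1 h1
  have h2' := abs_le.1 h2
  rw [abs_le]
  constructor
  · refine le_of_mul_le_mul_left ?_ hp
    nlinarith [h1'.1, h2'.2]
  · refine le_of_mul_le_mul_left ?_ hp
    nlinarith [h1'.2, h2'.1]

lemma exists_top_subset {ι : Type*} [DecidableEq ι] (f : ι → ℝ) (S : Finset ι) (k : ℕ)
    (hk : k ≤ #S) : ∃ T ⊆ S, #T = k ∧ ∀ i ∈ T, ∀ j ∈ S \ T, f j ≤ f i := by
  induction k with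
  | zero => exact ⟨∅, by simp⟩
  | succ k ih =>
    obtain ⟨T, hTS, hT, hle⟩ := ih (by omega)
    have hne : (S \ T).Nonempty := by
      rw [← card_pos, card_sdiff_of_subset hTS]
      omega
    obtain ⟨x, hx, hmax⟩ := exists_max_image (S \ T) f hne
    rw [mem_sdiff] at hx
    refine ⟨insert x T, insert_subset hx.1 hTS, by rw [card_insert_of_notMem hx.2, hT], ?_⟩
    intro i hi j hj
    have hj' : j ∈ S \ T := by
      simp only [mem_sdiff, mem_insert, not_or] at hj ⊢
      exact ⟨hj.1, hj.2.2⟩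
    rcases mem_insert.1 hi with rfl | hi
    · exact hmax j hj'
    · exact hle i hi j hj'

variable {N : ℕ}

@[simp] lemma restr_apply (S : Finset (Fin N)) (v : EuclideanSpace ℝ (Fin N)) (j : Fin N) :
    restr S v j = if j ∈ S then v j else 0 := rfl

lemma norm_sq_restr (S : Finset (Fin N)) (v : EuclideanSpace ℝ (Fin N)) :
    ‖restr S v‖ ^ 2 = ∑ j ∈ S, v j ^ 2 := by
  rw [EuclideanSpace.real_norm_sq_eq]
  simp

lemma restr_union {S T : Finset (Fin N)} (h : Disjoint S T) (v : EuclideanSpace ℝ (Fin N)) :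
    restr (S ∪ T) v = restr S v + restr T v := by
  ext j
  have : j ∈ S → j ∉ T := fun h1 h2 => disjoint_left.1 h h1 h2
  by_cases h1 : j ∈ S <;> by_cases h2 : j ∈ T <;> simp_all

lemma restr_univ (v : EuclideanSpace ℝ (Fin N)) : restr univ v = v := by
  ext j
  simp

lemma isSparse_of_subset {s : ℕ} {v : EuclideanSpace ℝ (Fin N)} (T : Finset (Fin N))
    (hT : #T ≤ s) (h : ∀ j, v j ≠ 0 → j ∈ T) : IsSparse s v := by
  refine le_trans ?_ hT
  rw [← Set.ncard_coe_finset]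
  exact Set.ncard_le_ncard (fun j hj => h j hj) T.finite_toSet

/-- Disjoint supports are orthogonal, and every combination of the two vectors is `2k`-sparse, so
RIP polarizes to near-orthogonality of the images. -/
lemma abs_inner_map_restr_le {F : Type*} [NormedAddCommGroup F] [InnerProductSpace ℝ F]
    {L : EuclideanSpace ℝ (Fin N) →ₗ[ℝ] F} {k : ℕ} {δ : ℝ} (hL : HasRIP L (2 * k) δ)
    (v w : EuclideanSpace ℝ (Fin N)) {T S : Finset (Fin N)} (hTS : Disjoint T S) (hT : #T ≤ k)
    (hS : #S ≤ k) :
    |inner ℝ (L (restr T v)) (L (restr S w))| ≤ δ * ‖restr T v‖ * ‖restr S w‖ := by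
  have h0 : inner ℝ (restr T v) (restr S w) = 0 := by
    rw [PiLp.inner_apply]
    refine sum_eq_zero fun j _ => ?_
    have : j ∈ T → j ∉ S := fun h1 h2 => disjoint_left.1 hTS h1 h2
    by_cases h1 : j ∈ T <;> simp_all
  have := abs_inner_map_sub_inner_le L (δ := δ) (restr T v) (restr S w) fun a b => hL _
    (isSparse_of_subset (T ∪ S) ((card_union_le _ _).trans (by omega)) fun j hj => by
      by_contra hc
      simp_all)
  rwa [h0, sub_zero] at this

lemma norm_restr_le_mul {S : Finset (Fin N)} {v : EuclideanSpace ℝ (Fin N)} {k : ℕ} {a : ℝ}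
    (ha : 0 ≤ a) (hv : ∀ j ∈ S, |v j| ≤ a) (hS : #S ≤ k) : ‖restr S v‖ ≤ √k * a := by
  refine abs_le_of_sq_le_sq' ?_ (by positivity) |>.2
  rw [norm_sq_restr, mul_pow, Real.sq_sqrt (Nat.cast_nonneg k)]
  calc ∑ j ∈ S, v j ^ 2 ≤ ∑ j ∈ S, a ^ 2 :=
        sum_le_sum fun j hj => sq_le_sq.2 (by rw [abs_of_nonneg ha]; exact hv j hj)
    _ = #S * a ^ 2 := by simp
    _ ≤ k * a ^ 2 := by gcongr

lemma le_sum_div_of_top {T : Finset (Fin N)} {f : Fin N → ℝ} {k : ℕ} (hk : 1 ≤ k) (hT : #T = k)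
    {x : ℝ} (hx : ∀ i ∈ T, x ≤ f i) : x ≤ (∑ i ∈ T, f i) / k := by
  have hk' : (0 : ℝ) < k := by exact_mod_cast hk
  rw [le_div_iff₀ hk']
  have := card_nsmul_le_sum T f x hx
  rw [hT, nsmul_eq_mul] at this
  linarith

lemma sqrt_mul_div_self (k x : ℝ) : √k * (x / k) = x / √k := by
  rw [← mul_div_assoc, mul_comm, mul_div_assoc, Real.sqrt_div_self, div_eq_mul_inv]

/-- Closing arithmetic for `HasRIP.norm_sub_le`: the interaction terms total at most `(1/4 + 1/8) X
^ 2`, leaving `3/8 X ^ 2 ≤ 12/5 X τ`, that is `X ≤ 6.4 τ`. -/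
lemma le_of_sq_interaction_le {X x y i j Y τ : ℝ} (hX : 0 ≤ X) (hτ : 0 ≤ τ)
    (hX2 : X ^ 2 = x ^ 2 + y ^ 2) (hi : |i| ≤ 1 / 4 * x * x) (hj : |j| ≤ 1 / 4 * y * x)
    (hY : 3 / 4 * X ^ 2 ≤ Y) (hY' : Y ≤ 6 / 5 * X * (2 * τ) - (i + j)) : X ≤ 7 * τ := by
  rcases hX.eq_or_lt with h0 | h0
  · linarith
  · refine le_of_mul_le_mul_left ?_ h0
    have h1 := (abs_le.1 hi).1
    have h2 := (abs_le.1 hj).1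
    have h3 := mul_nonneg hX hτ
    have h4 : y * x ≤ X ^ 2 / 2 := by linarith [two_mul_le_add_sq x y]
    have h5 := sq_nonneg y
    linarith

/-- Interaction of a sparse vector with a vector of small entries, by decomposition of the latter
into blocks of decreasing entries. -/
lemma abs_inner_map_tail_le {F : Type*} [NormedAddCommGroup F] [InnerProductSpace ℝ F]
    {L : EuclideanSpace ℝ (Fin N) →ₗ[ℝ] F} {k : ℕ} (hk : 1 ≤ k) {δ : ℝ} (hδ : 0 ≤ δ)
    (hL : HasRIP L (2 * k) δ) (v : EuclideanSpace ℝ (Fin N)) {T : Finset (Fin N)} (hT : #T ≤ k)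
    (S : Finset (Fin N)) (hTS : Disjoint T S) (a : ℝ) (ha : 0 ≤ a) (hv : ∀ j ∈ S, |v j| ≤ a) :
    |inner ℝ (L (restr T v)) (L (restr S v))| ≤
      δ * ‖restr T v‖ * (√k * a + (∑ j ∈ S, |v j|) / √k) := by
  have hk' : (0 : ℝ) < √k := Real.sqrt_pos.2 (by exact_mod_cast hk)
  induction S using Finset.strongInduction generalizing a with
  | H S ih =>
    rcases le_or_gt #S k with hS | hS
    · refine (abs_inner_map_restr_le hL v v hTS hT hS).trans ?_
      gcongr
      exact (norm_restr_le_mul ha hv hS).trans (le_add_of_nonneg_right (by positivity))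
    · obtain ⟨U, hUS, hU, htop⟩ := exists_top_subset (fun j => |v j|) S k hS.le
      have hdisj : Disjoint U (S \ U) := disjoint_sdiff
      have hsplit : restr S v = restr U v + restr (S \ U) v := by
        rw [← restr_union hdisj, union_sdiff_of_subset hUS]
      have hsum : ∑ j ∈ S, |v j| = ∑ j ∈ U, |v j| + ∑ j ∈ S \ U, |v j| := by
        rw [← sum_union hdisj, union_sdiff_of_subset hUS]
      have hss : S \ U ⊂ S := sdiff_ssubset hUS (card_pos.1 (by omega))
      -- Entries outside the top block `U` are at most its average. With this new bound `√k * a`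
      -- becomes `(∑ j ∈ U, |v j|) / √k`, exactly the share of `U` in the `ℓ¹` term, so the estimate
      -- telescopes.
      have h1 := ih (S \ U) hss (hTS.mono_right sdiff_subset) ((∑ j ∈ U, |v j|) / k)
        (by positivity) fun j hj => le_sum_div_of_top hk hU fun i hi => htop i hi j hj
      have h2 := (abs_inner_map_restr_le hL v v (hTS.mono_right hUS) hT hU.le).trans
        (mul_le_mul_of_nonneg_left (norm_restr_le_mul ha (fun j hj => hv j (hUS hj)) hU.le)
          (by positivity))
      rw [sqrt_mul_div_self] at h1
      rw [hsplit, map_add, inner_add_right, hsum]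
      refine (abs_add_le _ _).trans ((add_le_add h2 h1).trans (le_of_eq ?_))
      ring

set_option maxHeartbeats 1000000 in
/-- Stable recovery of sparse vectors by `ℓ¹` minimization under the restricted isometry
property. -/
theorem HasRIP.norm_sub_le {F : Type*} [NormedAddCommGroup F] [InnerProductSpace ℝ F]
    {L : EuclideanSpace ℝ (Fin N) →ₗ[ℝ] F} {k : ℕ} (hk : 1 ≤ k) (hkN : 2 * k ≤ N)
    (hL : HasRIP L (2 * k) (1 / 4)) {τ : ℝ} {c c₀ : EuclideanSpace ℝ (Fin N)}
    (hc₀ : IsSparse k c₀) (hl1 : l1 c ≤ l1 c₀) (hτ : ‖L (c - c₀)‖ ≤ 2 * τ) :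
    ‖c - c₀‖ ≤ 16 * τ := by
  set h := c - c₀ with hh
  set T₀ : Finset (Fin N) := univ.filter fun j => c₀ j ≠ 0
  have hT₀ : #T₀ ≤ k := by
    have : {j | c₀ j ≠ 0} = (T₀ : Set (Fin N)) := by ext j; simp [T₀]
    rwa [IsSparse, this, Set.ncard_coe_finset] at hc₀
  -- Cone condition: since `c` has no larger `ℓ¹` norm than `c₀`, mass gained off the support of
  -- `c₀` must be lost on it.
  have hcone : ∑ j ∈ T₀ᶜ, |h j| ≤ ∑ j ∈ T₀, |h j| := by
    have e1 : l1 c = ∑ j ∈ T₀, |c j| + ∑ j ∈ T₀ᶜ, |c j| := (sum_add_sum_compl _ _).symm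
    have e2 : l1 c₀ = ∑ j ∈ T₀, |c₀ j| := by
      rw [l1, ← sum_add_sum_compl T₀, add_eq_left]
      exact sum_eq_zero fun j hj => by simp_all [T₀]
    have e3 : ∑ j ∈ T₀ᶜ, |c j| = ∑ j ∈ T₀ᶜ, |h j| := by
      refine sum_congr rfl fun j hj => ?_
      have : c₀ j = 0 := by simpa [T₀] using hj
      simp [hh, this]
    have e4 : ∑ j ∈ T₀, (|c₀ j| - |h j|) ≤ ∑ j ∈ T₀, |c j| := by
      refine sum_le_sum fun j _ => ?_
      have := abs_sub_abs_le_abs_sub (c₀ j) (c j)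
      rw [abs_sub_comm] at this
      simp only [hh, PiLp.sub_apply]
      linarith
    rw [sum_sub_distrib] at e4
    linarith
  obtain ⟨T₁, hT₁s, hT₁, htop⟩ := exists_top_subset (fun j => |h j|) T₀ᶜ k (by
    rw [card_compl, Fintype.card_fin]; omega)
  set S := T₀ᶜ \ T₁
  have hd01 : Disjoint T₀ T₁ := disjoint_compl_right.mono_right hT₁s
  have hd0S : Disjoint T₀ S := disjoint_compl_right.mono_right sdiff_subset
  have hd1S : Disjoint T₁ S := disjoint_sdiff
  have hdS : Disjoint (T₀ ∪ T₁) S := disjoint_union_left.2 ⟨hd0S, hd1S⟩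
  have hun : T₁ ∪ S = T₀ᶜ := union_sdiff_of_subset hT₁s
  have hunion : T₀ ∪ T₁ ∪ S = univ := by rw [union_assoc, hun, union_compl]
  have hk0 : (0 : ℝ) < k := by exact_mod_cast hk
  have hk' : (0 : ℝ) < √k := Real.sqrt_pos.2 hk0
  set a := (∑ j ∈ T₁, |h j|) / k with ha
  have ha0 : 0 ≤ a := by positivity
  have hSa : ∀ j ∈ S, |h j| ≤ a :=
    fun j hj => le_sum_div_of_top hk hT₁ fun i hi => htop i hi j hj
  have hsum : ∑ j ∈ T₁, |h j| + ∑ j ∈ S, |h j| ≤ ∑ j ∈ T₀, |h j| := by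
    rw [← sum_union hd1S, hun]
    exact hcone
  set x₀ := ‖restr T₀ h‖ with hx₀
  set x₁ := ‖restr T₁ h‖ with hx₁
  set X := ‖restr (T₀ ∪ T₁) h‖ with hX
  have hX2 : X ^ 2 = x₀ ^ 2 + x₁ ^ 2 := by
    rw [hX, hx₀, hx₁, norm_sq_restr, norm_sq_restr, norm_sq_restr, sum_union hd01]
  have ht : (∑ j ∈ T₀, |h j|) ≤ √k * x₀ := by
    refine abs_le_of_sq_le_sq' ?_ (by positivity) |>.2
    rw [mul_pow, Real.sq_sqrt hk0.le, hx₀, norm_sq_restr]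
    refine (sq_sum_le_card_mul_sum_sq).trans ?_
    simp only [sq_abs]
    gcongr
  -- The left side is the `ℓ¹` mass of `h` off `T₀` over `√k`; the cone condition and Cauchy–Schwarz
  -- bound it by the `ℓ²` norm on `T₀`.
  have htail : √k * a + (∑ j ∈ S, |h j|) / √k ≤ x₀ := by
    rw [ha, sqrt_mul_div_self, ← add_div, div_le_iff₀ hk', mul_comm]
    linarith
  have hi0 := abs_inner_map_tail_le hk (by norm_num) hL h hT₀ S hd0S a ha0 hSa
  have hi1 := abs_inner_map_tail_le hk (by norm_num) hL h hT₁.le S hd1S a ha0 hSa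
  have hX0 : 0 ≤ X := norm_nonneg _
  have hx₀0 : 0 ≤ x₀ := norm_nonneg _
  have hx₁0 : 0 ≤ x₁ := norm_nonneg _
  have hi0' : |inner ℝ (L (restr T₀ h)) (L (restr S h))| ≤ 1 / 4 * x₀ * x₀ :=
    hi0.trans (mul_le_mul_of_nonneg_left htail (by positivity))
  have hi1' : |inner ℝ (L (restr T₁ h)) (L (restr S h))| ≤ 1 / 4 * x₁ * x₀ :=
    hi1.trans (mul_le_mul_of_nonneg_left htail (by positivity))
  have hsplit : L h = L (restr (T₀ ∪ T₁) h) + L (restr S h) := by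
    rw [← map_add, ← restr_union hdS, hunion, restr_univ]
  have hin : ‖L (restr (T₀ ∪ T₁) h)‖ ^ 2 = inner ℝ (L (restr (T₀ ∪ T₁) h)) (L h) -
      (inner ℝ (L (restr T₀ h)) (L (restr S h)) + inner ℝ (L (restr T₁ h)) (L (restr S h))) := by
    rw [← inner_add_left, ← map_add, ← restr_union hd01, ← inner_sub_right, hsplit,
      add_sub_cancel_right, real_inner_self_eq_norm_sq]
  have hrip := abs_le.1 (hL (restr (T₀ ∪ T₁) h) (isSparse_of_subset (T₀ ∪ T₁)
    ((card_union_le _ _).trans (by omega)) fun j hj => by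
      by_contra hc
      rw [restr_apply, if_neg hc] at hj
      exact hj rfl))
  rw [← hX] at hrip
  -- `√(1 + 1/4) < 6/5`.
  have hLX : ‖L (restr (T₀ ∪ T₁) h)‖ ≤ 6 / 5 * X := by
    refine abs_le_of_sq_le_sq' ?_ (by positivity) |>.2
    nlinarith [hrip.2, sq_nonneg X]
  have hτ0 : 0 ≤ τ := by linarith [norm_nonneg (L h)]
  have hcs : inner ℝ (L (restr (T₀ ∪ T₁) h)) (L h) ≤ 6 / 5 * X * (2 * τ) :=
    (real_inner_le_norm _ _).trans (mul_le_mul hLX hτ (norm_nonneg _) (by positivity))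
  have hXτ : X ≤ 7 * τ := by
    refine le_of_sq_interaction_le hX0 hτ0 hX2 hi0' hi1' ?_ (hin.le.trans (sub_le_sub_right hcs _))
    linarith [hrip.1]
  have hSnorm : ‖restr S h‖ ^ 2 ≤ X ^ 2 := by
    have e0 : 0 ≤ ∑ j ∈ S, |h j| := sum_nonneg fun _ _ => abs_nonneg _
    have e1 : 0 ≤ ∑ j ∈ T₁, |h j| := sum_nonneg fun _ _ => abs_nonneg _
    calc ‖restr S h‖ ^ 2 = ∑ j ∈ S, h j ^ 2 := norm_sq_restr _ _
      _ ≤ ∑ j ∈ S, a * |h j| := sum_le_sum fun j hj => by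
          rw [← sq_abs, sq]
          exact mul_le_mul_of_nonneg_right (hSa j hj) (abs_nonneg _)
      _ = (∑ j ∈ T₁, |h j|) * (∑ j ∈ S, |h j|) / k := by
          rw [← mul_sum, ha]
          ring
      _ ≤ (√k * x₀) * (√k * x₀) / k := by
          refine div_le_div_of_nonneg_right (mul_le_mul ?_ ?_ e0 ?_) hk0.le <;> linarith
      _ = x₀ ^ 2 := by
          rw [mul_mul_mul_comm, Real.mul_self_sqrt hk0.le]
          field_simp
      _ ≤ X ^ 2 := by nlinarith [sq_nonneg x₁]
  -- Head and tail give `‖h‖ ^ 2 ≤ 2 * (7 * τ) ^ 2`, well below `(16 * τ) ^ 2`.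
  refine abs_le_of_sq_le_sq' ?_ (by positivity) |>.2
  have hfin : ‖h‖ ^ 2 = X ^ 2 + ‖restr S h‖ ^ 2 := by
    rw [hX, norm_sq_restr, norm_sq_restr, ← sum_union hdS, hunion, EuclideanSpace.real_norm_sq_eq]
  rw [hfin]
  nlinarith [mul_self_le_mul_self hX0 hXτ]

end SparseRecovery

end KSSRecovery

namespace KSSRecovery

/-! ### Nets of the unit ball and near-isometries. -/

section Nets

open Module Metric

variable {E : Type*} [NormedAddCommGroup E] [NormedSpace ℝ E] [FiniteDimensional ℝ E]

/-- Volume bound for a `1/4`-separated subset of the unit ball. -/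
lemma card_le_of_separated_quarter (s : Finset E) (hs : ∀ c ∈ s, ‖c‖ ≤ 1)
    (h : ∀ c ∈ s, ∀ d ∈ s, c ≠ d → 1 / 4 ≤ ‖c - d‖) : s.card ≤ 9 ^ finrank ℝ E := by
  borelize E
  let μ : Measure E := Measure.addHaar
  -- Disjoint balls of radius `1/8` inside one of radius `9/8`: the volume ratio is `9 ^ dim`.
  have hdisj : Set.Pairwise (s : Set E) (Function.onFun Disjoint fun c => ball c (1 / 8 : ℝ)) := by
    rintro c hc d hd hcd
    apply ball_disjoint_ball
    rw [dist_eq_norm]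
    linarith [h c hc d hd hcd]
  have hsub : (⋃ c ∈ s, ball c (1 / 8 : ℝ)) ⊆ ball (0 : E) (9 / 8) := by
    refine Set.iUnion₂_subset fun x hx => ball_subset_ball' ?_
    rw [dist_zero_right]
    linarith [hs x hx]
  have hI : (s.card : ENNReal) * ENNReal.ofReal ((1 / 8 : ℝ) ^ finrank ℝ E) * μ (ball 0 1) ≤
      ENNReal.ofReal ((9 / 8 : ℝ) ^ finrank ℝ E) * μ (ball 0 1) := by
    calc _ = μ (⋃ c ∈ s, ball c (1 / 8 : ℝ)) := by
          rw [measure_biUnion_finset hdisj fun c _ => measurableSet_ball]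
          simp only [μ.addHaar_ball_of_pos _ (by norm_num : (0 : ℝ) < 1 / 8)]
          simp only [Finset.sum_const, nsmul_eq_mul, mul_assoc]
      _ ≤ μ (ball (0 : E) (9 / 8)) := measure_mono hsub
      _ = _ := μ.addHaar_ball_of_pos _ (by norm_num)
  have hJ := (ENNReal.mul_le_mul_iff_left (measure_ball_pos _ _ zero_lt_one).ne'
    measure_ball_lt_top.ne).1 hI
  have hK : (s.card : ℝ) ≤ (9 : ℝ) ^ finrank ℝ E := by
    have := ENNReal.toReal_le_of_le_ofReal (by positivity) hJ
    simpa [div_eq_mul_inv, mul_pow] using this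
  exact mod_cast hK

variable (E) in
/-- The unit ball has a `1/4`-net of at most `9 ^ dim` points. -/
lemma exists_net_unit_ball : ∃ s : Finset E, s.card ≤ 9 ^ finrank ℝ E ∧ (∀ c ∈ s, ‖c‖ ≤ 1) ∧
    ∀ x : E, ‖x‖ ≤ 1 → ∃ y ∈ s, ‖x - y‖ ≤ 1 / 4 := by
  classical
  let P : Finset E → Prop := fun s =>
    (∀ c ∈ s, ‖c‖ ≤ 1) ∧ ∀ c ∈ s, ∀ d ∈ s, c ≠ d → 1 / 4 ≤ ‖c - d‖
  let A : Set ℕ := {n | ∃ s, P s ∧ s.card = n}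
  have hbdd : BddAbove A := ⟨9 ^ finrank ℝ E, by
    rintro n ⟨s, hs, rfl⟩
    exact card_le_of_separated_quarter s hs.1 hs.2⟩
  -- A separated set of maximal cardinality is a net, since a point far from it could be added.
  obtain ⟨s, hs, hcard⟩ : sSup A ∈ A := Nat.sSup_mem ⟨0, ∅, by simp [P], rfl⟩ hbdd
  refine ⟨s, card_le_of_separated_quarter s hs.1 hs.2, hs.1, fun x hx => ?_⟩
  by_contra! hfar
  have hxs : x ∉ s := fun hmem => by
    have := hfar x hmem
    norm_num at this
  have hP : P (insert x s) := by
    refine ⟨fun c hc => ?_, fun c hc d hd hcd => ?_⟩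
    · rcases Finset.mem_insert.1 hc with rfl | hc
      · exact hx
      · exact hs.1 c hc
    · rcases Finset.mem_insert.1 hc with rfl | hc' <;> rcases Finset.mem_insert.1 hd with rfl | hd'
      · exact absurd rfl hcd
      · exact (hfar d hd').le
      · rw [norm_sub_rev]
        exact (hfar c hc').le
      · exact hs.2 c hc' d hd' hcd
  have := le_csSup hbdd (show (insert x s).card ∈ A from ⟨_, hP, rfl⟩)
  rw [Finset.card_insert_of_notMem hxs] at this
  omega

/-- Near-isometry on a `1/4`-net of the unit ball implies near-isometry everywhere. -/
lemma abs_norm_sq_map_sub_le_of_net {E F : Type*} [NormedAddCommGroup E] [InnerProductSpace ℝ E]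
    [FiniteDimensional ℝ E] [NormedAddCommGroup F] [InnerProductSpace ℝ F] (L : E →ₗ[ℝ] F)
    {s : Finset E} (hs : ∀ c ∈ s, ‖c‖ ≤ 1) (hnet : ∀ x : E, ‖x‖ ≤ 1 → ∃ y ∈ s, ‖x - y‖ ≤ 1 / 4)
    {t : ℝ} (ht : ∀ v ∈ s, |‖L v‖ ^ 2 - ‖v‖ ^ 2| ≤ t) (x : E) :
    |‖L x‖ ^ 2 - ‖x‖ ^ 2| ≤ 2 * t * ‖x‖ ^ 2 := by
  let g : E → ℝ := fun x => |‖L x‖ ^ 2 - ‖x‖ ^ 2|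
  have hLc : Continuous L := L.continuous_of_finiteDimensional
  have hg : Continuous g := by
    fun_prop
  have hsm : ∀ (a : ℝ) (x : E), g (a • x) = a ^ 2 * g x := by
    intro a x
    simp only [g, map_smul, norm_smul, mul_pow, Real.norm_eq_abs, sq_abs]
    rw [← mul_sub, abs_mul, abs_of_nonneg (sq_nonneg a)]
  obtain ⟨x₀, hx₀, hmax⟩ := (isCompact_closedBall (0 : E) 1).exists_isMaxOn
    ⟨0, by simp⟩ hg.continuousOn
  have hle : ∀ x : E, ‖x‖ ≤ 1 → g x ≤ g x₀ := fun x hx => hmax (by simpa using hx)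
  have hhom : ∀ x : E, g x ≤ g x₀ * ‖x‖ ^ 2 := by
    intro x
    rcases eq_or_ne x 0 with rfl | hx
    · simp [g]
    · have hx' : 0 < ‖x‖ := norm_pos_iff.2 hx
      have := hle (‖x‖⁻¹ • x) (by rw [norm_smul, norm_inv, norm_norm, inv_mul_cancel₀ hx'.ne'])
      rw [hsm, inv_pow, inv_mul_le_iff₀ (by positivity)] at this
      linarith
  have hx₀' : ‖x₀‖ ≤ 1 := by simpa using hx₀
  obtain ⟨v, hv, hxv⟩ := hnet x₀ hx₀'
  -- The form `‖L x‖ ^ 2 - ‖x‖ ^ 2` changes between `x₀` and `v` by its polarization at `x₀ - v`,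
  -- `x₀ + v`, hence by at most `g x₀ * (1 / 4) * 2`. This half of the maximum is absorbed, giving
  -- `g x₀ ≤ 2 * t`.
  have hpol := abs_inner_map_sub_inner_le L (δ := g x₀) (x₀ - v) (x₀ + v) fun a b => hhom _
  have e1 : inner ℝ (L (x₀ - v)) (L (x₀ + v)) - inner ℝ (x₀ - v) (x₀ + v) =
      (‖L x₀‖ ^ 2 - ‖x₀‖ ^ 2) - (‖L v‖ ^ 2 - ‖v‖ ^ 2) := by
    simp only [map_sub, map_add, inner_sub_left, inner_add_right, real_inner_self_eq_norm_sq]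
    rw [real_inner_comm (L x₀), real_inner_comm x₀]
    ring
  rw [e1] at hpol
  have hg0 : 0 ≤ g x₀ := abs_nonneg _
  have e2 : g x₀ * ‖x₀ - v‖ * ‖x₀ + v‖ ≤ g x₀ * (1 / 4) * 2 := by
    gcongr
    linarith [norm_add_le x₀ v, hs v hv]
  have e3 : g x₀ - t ≤ g x₀ * (1 / 4) * 2 := by
    refine le_trans ?_ (hpol.trans e2)
    refine le_trans ?_ (abs_sub_abs_le_abs_sub _ _)
    exact sub_le_sub_left (ht v hv) _
  exact (hhom x).trans (mul_le_mul_of_nonneg_right (by linarith) (sq_nonneg _))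

/-- Extension by zero of a vector indexed by `T`. -/
noncomputable def extend {N : ℕ} (T : Finset (Fin N)) :
    EuclideanSpace ℝ T →ₗ[ℝ] EuclideanSpace ℝ (Fin N) where
  toFun v := WithLp.toLp 2 fun j => if h : j ∈ T then v ⟨j, h⟩ else 0
  map_add' u v := by
    ext j
    by_cases h : j ∈ T <;> simp [h]
  map_smul' a v := by
    ext j
    by_cases h : j ∈ T <;> simp [h]

lemma extend_apply {N : ℕ} (T : Finset (Fin N)) (v : EuclideanSpace ℝ T) (j : Fin N) :
    extend T v j = if h : j ∈ T then v ⟨j, h⟩ else 0 := rfl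

lemma norm_extend {N : ℕ} (T : Finset (Fin N)) (v : EuclideanSpace ℝ T) : ‖extend T v‖ = ‖v‖ := by
  rw [← sq_eq_sq₀ (norm_nonneg _) (norm_nonneg _), EuclideanSpace.real_norm_sq_eq,
    EuclideanSpace.real_norm_sq_eq, ← Finset.sum_subset (Finset.subset_univ T), ← Finset.sum_coe_sort]
  · refine Finset.sum_congr rfl fun j _ => ?_
    simp [extend_apply]
  · intro j _ hj
    simp [extend_apply, hj]

/-- A finite set of test vectors, on which near-isometry implies the restricted isometry
property. -/
lemma exists_test_vectors {N : ℕ} (T : Finset (Fin N)) :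
    ∃ V : Finset (EuclideanSpace ℝ (Fin N)), V.card ≤ 9 ^ T.card ∧ (∀ v ∈ V, ‖v‖ ≤ 1) ∧
      ∀ (F : Type) [NormedAddCommGroup F] [InnerProductSpace ℝ F]
        (L : EuclideanSpace ℝ (Fin N) →ₗ[ℝ] F) (t : ℝ),
        (∀ v ∈ V, |‖L v‖ ^ 2 - ‖v‖ ^ 2| ≤ t) →
        ∀ x : EuclideanSpace ℝ (Fin N), (∀ j, x j ≠ 0 → j ∈ T) →
          |‖L x‖ ^ 2 - ‖x‖ ^ 2| ≤ 2 * t * ‖x‖ ^ 2 := by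
  classical
  obtain ⟨s, hcard, hs, hnet⟩ := exists_net_unit_ball (EuclideanSpace ℝ T)
  rw [finrank_euclideanSpace, Fintype.card_coe] at hcard
  refine ⟨s.image (extend T), Finset.card_image_le.trans hcard, ?_, ?_⟩
  · intro v hv
    obtain ⟨w, hw, rfl⟩ := Finset.mem_image.1 hv
    rw [norm_extend]
    exact hs w hw
  · intro F _ _ L t ht x hx
    have hxe : x = extend T (WithLp.toLp 2 fun j => x j) := by
      ext j
      rw [extend_apply]
      split_ifs with h
      · rfl
      · by_contra hne
        exact h (hx j hne)
    have := abs_norm_sq_map_sub_le_of_net (L ∘ₗ extend T) hs hnet (t := t) (fun v hv => by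
      have := ht _ (Finset.mem_image_of_mem _ hv)
      rwa [norm_extend] at this) (WithLp.toLp 2 fun j : T => x j)
    rwa [← norm_extend T (WithLp.toLp 2 fun j : T => x j), LinearMap.comp_apply, ← hxe] at this

end Nets

end KSSRecovery

namespace KSSRecovery

/-! ### Concentration of sums of squares of normal variables. -/

section ChiSquare

variable {Ω : Type*} [MeasurableSpace Ω] {P : Measure Ω}

lemma integral_exp_mul_sq_gaussianReal {v : ℝ≥0} (hv : v ≠ 0) {s : ℝ} (hs : 2 * s * v < 1) :
    ∫ x, Real.exp (s * x ^ 2) ∂(gaussianReal 0 v) =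
      Real.exp (-(1 / 2 * Real.log (1 - 2 * s * v))) := by
  have hv' : (0 : ℝ) < v := by positivity
  have hpos : 0 < 1 - 2 * s * v := by linarith
  rw [integral_gaussianReal_eq_integral_smul hv]
  have h1 : ∀ x : ℝ, gaussianPDFReal 0 v x • Real.exp (s * x ^ 2) =
      (√(2 * Real.pi * v))⁻¹ * Real.exp (-((1 - 2 * s * v) / (2 * v)) * x ^ 2) := by
    intro x
    rw [gaussianPDFReal, smul_eq_mul, mul_assoc, ← Real.exp_add]
    congr 2
    field_simp
    ring
  simp_rw [h1]
  rw [integral_const_mul, integral_gaussian]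
  have h2 : Real.pi / ((1 - 2 * s * v) / (2 * v)) = (2 * Real.pi * v) * (1 - 2 * s * v)⁻¹ := by
    field_simp
  have h3 : Real.exp (-(1 / 2 * Real.log (1 - 2 * s * v))) = √((1 - 2 * s * v)⁻¹) := by
    rw [Real.sqrt_eq_rpow, Real.rpow_def_of_pos (inv_pos.2 hpos), Real.log_inv]
    ring_nf
  rw [h2, h3, Real.sqrt_mul (x := 2 * Real.pi * v) (by positivity), inv_mul_cancel_left₀ (by positivity)]

lemma mgf_sum_sq_gaussianReal {m : ℕ} {Y : Fin m → Ω → ℝ} {v : ℝ≥0} (hv : v ≠ 0)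
    (hlaw : ∀ i, HasLaw (Y i) (gaussianReal 0 v) P) (hind : iIndepFun Y P) {s : ℝ}
    (hs : 2 * s * v < 1) :
    mgf (fun ω => ∑ i, Y i ω ^ 2) P s =
      Real.exp (-(m * (1 / 2 * Real.log (1 - 2 * s * v)))) := by
  have hind2 : iIndepFun (fun i ω => Y i ω ^ 2) P :=
    hind.comp (fun _ x => x ^ 2) fun _ => by fun_prop
  have hmeas : ∀ i, AEMeasurable (fun ω => Y i ω ^ 2) P := fun i =>
    (hlaw i).aemeasurable.pow_const 2
  have h1 : (fun ω => ∑ i, Y i ω ^ 2) = ∑ i, fun ω => Y i ω ^ 2 := by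
    ext ω
    simp
  rw [h1, hind2.mgf_sum₀ hmeas]
  have h2 : ∀ i, mgf (fun ω => Y i ω ^ 2) P s =
      Real.exp (-(1 / 2 * Real.log (1 - 2 * s * v))) := by
    intro i
    rw [← integral_exp_mul_sq_gaussianReal hv hs,
      ← (hlaw i).integral_comp (f := fun x => Real.exp (s * x ^ 2))
        (by fun_prop : Measurable fun x : ℝ => Real.exp (s * x ^ 2)).aestronglyMeasurable]
    rfl
  simp_rw [h2]
  rw [Finset.prod_const, Finset.card_univ, Fintype.card_fin, ← Real.exp_nat_mul]
  ring_nf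

/-- The integral of a non-integrable function is 0 by convention, so a positive value certifies
integrability. -/
lemma integrable_of_mgf_pos {X : Ω → ℝ} {s x : ℝ} (h : mgf X P s = Real.exp x) :
    Integrable (fun ω => Real.exp (s * X ω)) P := by
  by_contra hc
  rw [mgf, integral_undef hc] at h
  exact (Real.exp_pos x).ne h

/-- Concentration of a sum of squares of independent normal variables. -/
lemma measureReal_sum_sq_gaussianReal_le [IsProbabilityMeasure P] {m : ℕ} {Y : Fin m → Ω → ℝ}
    {v : ℝ≥0} (hv : v ≠ 0) (hlaw : ∀ i, HasLaw (Y i) (gaussianReal 0 v) P) (hind : iIndepFun Y P)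
    {η : ℝ} (hη0 : 0 < η) (hη1 : η < 1) :
    P.real {ω | η * (m * v) < |∑ i, Y i ω ^ 2 - m * v|} ≤ 2 * Real.exp (-(m * c₀ η)) := by
  have hv' : (0 : ℝ) < v := by positivity
  have hm : (0 : ℝ) ≤ m := Nat.cast_nonneg m
  have hη1' : 0 < 1 - η := by linarith
  have hup : P.real {ω | (1 + η) * (m * v) ≤ ∑ i, Y i ω ^ 2} ≤ Real.exp (-(m * c₀ η)) := by
    -- This `s` is the optimal Chernoff parameter; it produces the first branch of `c₀`, and its
    -- negative analogue below the second.
    have hx : 1 - 2 * (η / (2 * (1 + η) * v)) * v = 1 / (1 + η) := by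
      field_simp
      ring
    have hmgf := mgf_sum_sq_gaussianReal hv hlaw hind (s := η / (2 * (1 + η) * v)) (by
      have : 0 < 1 - 2 * (η / (2 * (1 + η) * v)) * v := by rw [hx]; positivity
      linarith)
    refine (measure_ge_le_exp_mul_mgf _ (by positivity) (integrable_of_mgf_pos hmgf)).trans ?_
    rw [hmgf, hx, ← Real.exp_add, Real.exp_le_exp]
    have h1 : -(η / (2 * (1 + η) * v)) * ((1 + η) * (m * v)) = -(m * (η / 2)) := by
      field_simp
    rw [h1]
    have h2 : m * c₀ η ≤ m * (1 / 2 * Real.log (1 / (1 + η)) + η / 2) :=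
      mul_le_mul_of_nonneg_left (min_le_left _ _) hm
    linarith
  have hlo : P.real {ω | ∑ i, Y i ω ^ 2 ≤ (1 - η) * (m * v)} ≤ Real.exp (-(m * c₀ η)) := by
    have hx : 1 - 2 * (-(η / (2 * (1 - η) * v))) * v = 1 / (1 - η) := by
      field_simp
      ring
    have hmgf := mgf_sum_sq_gaussianReal hv hlaw hind (s := -(η / (2 * (1 - η) * v))) (by
      have : 0 < 1 - 2 * (-(η / (2 * (1 - η) * v))) * v := by rw [hx]; positivity
      linarith)
    refine (measure_le_le_exp_mul_mgf _ (neg_nonpos.2 (by positivity))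
      (integrable_of_mgf_pos hmgf)).trans ?_
    rw [hmgf, hx, ← Real.exp_add, Real.exp_le_exp]
    have h1 : - -(η / (2 * (1 - η) * v)) * ((1 - η) * (m * v)) = m * (η / 2) := by
      field_simp
    rw [h1]
    have h2 : m * c₀ η ≤ m * (1 / 2 * Real.log (1 / (1 - η)) - η / 2) :=
      mul_le_mul_of_nonneg_left (min_le_right _ _) hm
    linarith
  calc _ ≤ P.real ({ω | (1 + η) * (m * v) ≤ ∑ i, Y i ω ^ 2} ∪
        {ω | ∑ i, Y i ω ^ 2 ≤ (1 - η) * (m * v)}) := by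
        refine measureReal_mono fun ω hω => ?_
        have hω' : η * (m * v) < |∑ i, Y i ω ^ 2 - m * v| := hω
        rcases lt_abs.1 hω' with h | h
        · left
          simp only [Set.mem_ofPred_eq]
          linarith
        · right
          simp only [Set.mem_ofPred_eq]
          linarith
    _ ≤ _ := (measureReal_union_le _ _).trans (by linarith)

/-- Independent linear combinations, over the rows of an array of independent centred normal
variables. -/
lemma rowSum_gaussian [IsProbabilityMeasure P] {m : ℕ} {κ : Type*} [Fintype κ]
    {A : Fin m → κ → Ω → ℝ} {var : κ → ℝ≥0}
    (hlaw : ∀ i α, HasLaw (A i α) (gaussianReal 0 (var α)) P)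
    (hind : iIndepFun (fun p : Fin m × κ => A p.1 p.2) P) (w : κ → ℝ) :
    (∀ i, HasLaw (fun ω => ∑ α, w α * A i α ω)
      (gaussianReal 0 (∑ α, w α ^ 2 * (var α : ℝ)).toNNReal) P) ∧
    iIndepFun (fun i ω => ∑ α, w α * A i α ω) P := by
  classical
  have hg : ∀ i α, HasGaussianLaw (A i α) P := fun i α => (hlaw i α).hasGaussianLaw
  have hmem : ∀ i α, MemLp (fun ω => w α * A i α ω) 2 P := fun i α =>
    (hg i α).memLp_two.const_mul _
  have hjoint : HasGaussianLaw (fun ω (p : Fin m × κ) => A p.1 p.2 ω) P :=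
    hind.hasGaussianLaw fun p => hg p.1 p.2
  let L : (Fin m × κ → ℝ) →L[ℝ] (Fin m → ℝ) :=
    ContinuousLinearMap.pi fun i => ∑ α, w α • ContinuousLinearMap.proj (i, α)
  have hY : HasGaussianLaw (fun ω i => ∑ α, w α * A i α ω) P := by
    have hL : (fun ω i => ∑ α, w α * A i α ω) = fun ω => L fun p => A p.1 p.2 ω := by
      ext ω i
      simp [L]
    rw [hL]
    exact hjoint.map_fun L
  have hcov : ∀ i α j β, (i, α) ≠ (j, β) → cov[A i α, A j β; P] = 0 := fun i α j β hne =>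
    (hind.indepFun (i := (i, α)) (j := (j, β)) hne).covariance_eq_zero
      (hg i α).memLp_two (hg j β).memLp_two
  have hmean : ∀ i α, ∫ ω, A i α ω ∂P = 0 := fun i α => by
    rw [(hlaw i α).integral_eq, integral_id_gaussianReal]
  -- The row sums are a linear image of a jointly Gaussian array, hence jointly Gaussian, so
  -- vanishing covariances suffice for independence.
  refine ⟨fun i => ?_, hY.iIndepFun_of_covariance_eq_zero fun i j hij => ?_⟩
  · have hYi : HasGaussianLaw (fun ω => ∑ α, w α * A i α ω) P := hY.eval i
    refine ⟨hYi.aemeasurable, ?_⟩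
    rw [hYi.map_eq_gaussianReal, integral_finsetSum _ fun α _ => (hmem i α).integrable one_le_two,
      variance_fun_sum (hmem i)]
    congr 2
    · refine Finset.sum_eq_zero fun α _ => ?_
      rw [integral_const_mul, hmean, mul_zero]
    · refine Finset.sum_congr rfl fun α _ => ?_
      rw [Finset.sum_eq_single α]
      · rw [covariance_const_mul_left, covariance_const_mul_right,
          covariance_self (hg i α).aemeasurable, (hlaw i α).variance_eq, variance_id_gaussianReal]
        ring
      · intro β _ hne
        rw [covariance_const_mul_left, covariance_const_mul_right, hcov, mul_zero, mul_zero]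
        simpa using hne.symm
      · simp
  · rw [covariance_fun_sum_fun_sum (hmem i) (hmem j)]
    refine Finset.sum_eq_zero fun α _ => Finset.sum_eq_zero fun β _ => ?_
    rw [covariance_const_mul_left, covariance_const_mul_right, hcov, mul_zero, mul_zero]
    simp [hij]

end ChiSquare

/-! ### The covariance kernel and its decay in the degree. -/

section Kernel

open Finset

/-- The multinomial theorem in inhomogeneous form. -/
lemma sum_kssVar_mul_prod_pow {n d : ℕ} (x : Fin n → ℝ) :
    ∑ α : MultiIndex n d, (kssVar α : ℝ) * ∏ j, x j ^ (α.1 j : ℕ) = ((1 + ∑ j, x j) / 2) ^ d := by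
  classical
  have hval : ∀ α : MultiIndex n d, (kssVar α : ℝ) =
      (d.choose α.deg * Nat.multinomial univ fun j => (α.1 j : ℕ)) / 2 ^ d := by
    intro α
    have hdeg : α.deg ≤ d := α.2
    have h1 : ((∏ j, ((α.1 j : ℕ)! : ℝ)) * Nat.multinomial univ fun j => (α.1 j : ℕ)) =
        (α.deg ! : ℝ) := by
      have := Nat.multinomial_spec univ fun j => (α.1 j : ℕ)
      rw [MultiIndex.deg, ← this]
      push_cast
      rfl
    have h2 : (d.choose α.deg : ℝ) * α.deg ! * (d - α.deg)! = d ! := by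
      exact_mod_cast Nat.choose_mul_factorial_mul_factorial hdeg
    have h3 : (∏ j, ((α.1 j : ℕ)! : ℝ)) ≠ 0 := prod_ne_zero_iff.2 fun j _ => by positivity
    have h4 : ((d - α.deg)! : ℝ) ≠ 0 := by positivity
    simp only [kssVar, NNReal.coe_div, NNReal.coe_mul, NNReal.coe_natCast, NNReal.coe_prod,
      NNReal.coe_pow, NNReal.coe_ofNat]
    congr 1
    rw [div_eq_iff (mul_ne_zero h4 h3), ← h2, ← h1]
    ring
  have hexp : (1 + ∑ j, x j) ^ d = ∑ r ∈ range (d + 1), ∑ β ∈ piAntidiag univ r,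
      (d.choose r : ℝ) * ((Nat.multinomial univ β : ℝ) * ∏ j, x j ^ β j) := by
    rw [add_comm, add_pow]
    refine sum_congr rfl fun r _ => ?_
    rw [sum_pow_eq_sum_piAntidiag, one_pow, mul_one, mul_comm, mul_sum]
  rw [div_pow, hexp, sum_sigma', sum_div]
  refine sum_bij' (fun α _ => ⟨α.deg, fun j => (α.1 j : ℕ)⟩)
    (fun p hp => ⟨fun j => ⟨p.2 j, ?_⟩, ?_⟩) ?_ ?_ ?_ ?_ ?_
  · simp only [mem_sigma, mem_range, mem_piAntidiag] at hp
    have h1 := single_le_sum (f := p.2) (fun _ _ => Nat.zero_le _) (mem_univ j)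
    have h2 : ∑ j, p.2 j = p.1 := hp.2.1
    omega
  · simp only [mem_sigma, mem_range, mem_piAntidiag] at hp
    have h2 : ∑ j, p.2 j = p.1 := hp.2.1
    simp only
    omega
  · intro α _
    have := α.2
    simp only [mem_sigma, mem_range, mem_piAntidiag, MultiIndex.deg]
    exact ⟨by omega, by simp⟩
  · intro p hp
    exact mem_univ _
  · intro α _
    rfl
  · rintro ⟨r, β⟩ hp
    simp only [mem_sigma, mem_range, mem_piAntidiag] at hp
    simp only [MultiIndex.deg]
    rw [hp.2.1]
  · intro α _
    rw [hval]
    ring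

/-- The correlation of the values of a Kostlan–Shub–Smale polynomial at two points. -/
noncomputable def corr {n : ℕ} (d : ℕ) (x y : Sph n) : ℝ :=
  ((1 + inner ℝ (x : EuclideanSpace ℝ (Fin n)) y) / 2) ^ d

lemma corr_self {n : ℕ} (d : ℕ) (x : Sph n) : corr d x x = 1 := by
  rw [corr, real_inner_self_eq_norm_sq, norm_eq_of_mem_sphere]
  norm_num

/-- Distinct unit vectors have inner product in `[-1, 1)`, so the base of the power lies in `[0,
1)`; antipodal points cause no trouble. -/
lemma tendsto_corr {n : ℕ} {x y : Sph n} (h : x ≠ y) :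
    Filter.Tendsto (fun d => corr d x y) Filter.atTop (nhds 0) := by
  refine tendsto_pow_atTop_nhds_zero_of_abs_lt_one ?_
  have hx : ‖(x : EuclideanSpace ℝ (Fin n))‖ = 1 := norm_eq_of_mem_sphere x
  have hy : ‖(y : EuclideanSpace ℝ (Fin n))‖ = 1 := norm_eq_of_mem_sphere y
  have h1 : inner ℝ (x : EuclideanSpace ℝ (Fin n)) y < 1 :=
    (inner_lt_one_iff_real_of_norm_eq_one hx hy).2 fun hc => h (Subtype.ext hc)
  have h2 := (abs_le.1 (abs_real_inner_le_norm (x : EuclideanSpace ℝ (Fin n)) y)).1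
  rw [hx, hy] at h2
  rw [abs_lt]
  constructor <;> linarith

/-- Both sides are the variance of `∑ j, v j * p (q j)` for a random polynomial `p`: by coefficients
on the left, by point values on the right. The multinomial identity at the coordinatewise products
of `q i` and `q j` links them. -/
lemma sum_kssVar_sq {n d N : ℕ} (q : Fin N → Sph n) (v : EuclideanSpace ℝ (Fin N)) :
    ∑ α : MultiIndex n d,
      (∑ j, v j * ∏ l, (q j : EuclideanSpace ℝ (Fin n)) l ^ (α.1 l : ℕ)) ^ 2 * (kssVar α : ℝ) =
      ∑ i, ∑ j, v i * v j * corr d (q i) (q j) := by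
  have h1 : ∀ i j, corr d (q i) (q j) = ∑ α : MultiIndex n d, (kssVar α : ℝ) *
      ∏ l, ((q i : EuclideanSpace ℝ (Fin n)) l * (q j : EuclideanSpace ℝ (Fin n)) l) ^
        (α.1 l : ℕ) := by
    intro i j
    rw [sum_kssVar_mul_prod_pow, corr, PiLp.inner_apply]
    simp [mul_comm]
  simp_rw [h1, mul_sum]
  rw [sum_congr rfl fun i _ => sum_comm, sum_comm]
  refine sum_congr rfl fun α _ => ?_
  rw [sq, sum_mul_sum, sum_mul]
  refine sum_congr rfl fun i _ => ?_
  rw [sum_mul]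
  refine sum_congr rfl fun j _ => ?_
  simp_rw [mul_pow]
  rw [prod_mul_distrib]
  ring

lemma abs_quadForm_sub_le {N : ℕ} (K : Fin N → Fin N → ℝ) {ε : ℝ} (hε : 0 ≤ ε)
    (hdiag : ∀ i, K i i = 1) (hoff : ∀ i j, i ≠ j → |K i j| ≤ ε) (v : EuclideanSpace ℝ (Fin N)) :
    |∑ i, ∑ j, v i * v j * K i j - ‖v‖ ^ 2| ≤ N * ε * ‖v‖ ^ 2 := by
  classical
  have h1 : ∑ i, ∑ j, v i * v j * K i j - ‖v‖ ^ 2 =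
      ∑ i, ∑ j, v i * v j * (K i j - if i = j then 1 else 0) := by
    rw [EuclideanSpace.real_norm_sq_eq, ← sum_sub_distrib]
    refine sum_congr rfl fun i _ => ?_
    simp_rw [mul_sub]
    rw [sum_sub_distrib]
    simp [sq]
  rw [h1]
  calc _ ≤ ∑ i, ∑ j, |v i * v j * (K i j - if i = j then 1 else 0)| :=
        (abs_sum_le_sum_abs _ _).trans (sum_le_sum fun i _ => abs_sum_le_sum_abs _ _)
    _ ≤ ∑ i, ∑ j, |v i| * |v j| * ε := by
        refine sum_le_sum fun i _ => sum_le_sum fun j _ => ?_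
        rw [abs_mul, abs_mul]
        refine mul_le_mul_of_nonneg_left ?_ (by positivity)
        split_ifs with h
        · rw [← h, hdiag]
          simpa using hε
        · simpa using hoff i j h
    _ = (∑ i, |v i|) ^ 2 * ε := by
        rw [sq, sum_mul_sum]
        simp_rw [sum_mul]
    _ ≤ (N * ‖v‖ ^ 2) * ε := by
        refine mul_le_mul_of_nonneg_right ?_ hε
        refine sq_sum_le_card_mul_sum_sq.trans (le_of_eq ?_)
        rw [EuclideanSpace.real_norm_sq_eq]
        simp
    _ = _ := by ring

/-- For large degree the values at distinct points are almost uncorrelated. -/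
lemma exists_degree_quadForm {n N : ℕ} (q : Fin N → Sph n) (hq : Function.Injective q) {ρ : ℝ}
    (hρ : 0 < ρ) : ∃ d₀ : ℕ, ∀ d, d₀ ≤ d → ∀ v : EuclideanSpace ℝ (Fin N),
      |∑ i, ∑ j, v i * v j * corr d (q i) (q j) - ‖v‖ ^ 2| ≤ ρ * ‖v‖ ^ 2 := by
  -- Summing the off-diagonal entries costs a factor `N`; `N + 1` also covers `N = 0`.
  have hε : 0 < ρ / (N + 1) := by positivity
  have hev : ∀ᶠ d in Filter.atTop, ∀ i j, i ≠ j → |corr d (q i) (q j)| ≤ ρ / (N + 1) := by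
    rw [Filter.eventually_all]
    intro i
    rw [Filter.eventually_all]
    intro j
    by_cases hij : i = j
    · exact Filter.Eventually.of_forall fun _ h => absurd hij h
    · have := (tendsto_corr (hq.ne hij)).abs
      rw [abs_zero] at this
      filter_upwards [this.eventually_le_const hε] with d hd _ using hd
  obtain ⟨d₀, hd₀⟩ := Filter.eventually_atTop.1 hev
  refine ⟨d₀, fun d hd v => (abs_quadForm_sub_le _ hε.le (fun i => corr_self d (q i))
    (hd₀ d hd) v).trans (mul_le_mul_of_nonneg_right ?_ (sq_nonneg _))⟩
  rw [mul_div_assoc', div_le_iff₀ (by positivity)]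
  nlinarith

end Kernel

end KSSRecovery

namespace KSSRecovery

/-! ### From restricted isometry to both recovery guarantees. -/

section Recovery

open Finset

/-- The measurement matrix as a linear map between Euclidean spaces. -/
noncomputable def matMap {m N : ℕ} (M : Matrix (Fin m) (Fin N) ℝ) :
    EuclideanSpace ℝ (Fin N) →ₗ[ℝ] EuclideanSpace ℝ (Fin m) where
  toFun := matApply M
  map_add' u v := by simp [matApply, Matrix.mulVec_add]
  map_smul' a v := by simp [matApply, Matrix.mulVec_smul]

lemma matMap_apply {m N : ℕ} (M : Matrix (Fin m) (Fin N) ℝ) (v : EuclideanSpace ℝ (Fin N)) :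
    matMap M v = matApply M v := rfl

lemma gridMoments_eq {n m N : ℕ} (f : Fin m → Sph n → ℝ) (q : Fin N → Sph n)
    (c : EuclideanSpace ℝ (Fin N)) : gridMoments f q c = matMap (measMatrix f q) c := by
  ext i
  simp [gridMoments, matMap_apply, matApply, measMatrix, Matrix.mulVec, dotProduct, mul_comm]

/-- The vector `cν` is itself feasible, so the minimizer has no larger `ℓ¹` norm; both images lie
within `τ` of `b_μ`, hence within `2 * τ` of each other. -/
lemma approxRecovery_of_hasRIP {n m N k : ℕ} {f : Fin m → Sph n → ℝ} {q : Fin N → Sph n}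
    (hk : 1 ≤ k) (hkN : 2 * k ≤ N) (h : HasRIP (matMap (measMatrix f q)) (2 * k) (1 / 4)) :
    ApproxRecovery k 16 f q := by
  intro μ _ τ cν hcν hν c hc
  rw [gridMoments_eq] at hν
  have h1 : ‖matMap (measMatrix f q) c - moments f μ‖ ≤ τ := hc.1
  refine h.norm_sub_le hk hkN hcν (hc.2 ?_) ?_
  · rwa [norm_sub_rev] at hν
  · rw [map_sub, ← sub_add_sub_cancel _ (moments f μ)]
    exact (norm_add_le _ _).trans (by linarith)

/-- A point measure supported on the grid is a sparse nonnegative combination of grid point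
masses. -/
lemma IsPointMeasure.exists_grid {n N k : ℕ} {q : Fin N → Sph n} (hq : Function.Injective q)
    {μ : Measure (Sph n)} (hμ : IsPointMeasure k μ) (hsupp : μ.support ⊆ Set.range q) :
    ∃ C : Fin N → ℝ≥0, {j | C j ≠ 0}.ncard ≤ k ∧ μ = ∑ j, C j • Measure.dirac (q j) := by
  classical
  obtain ⟨g, y, rfl⟩ := hμ
  -- Only atoms of nonzero weight are forced into the support; the others may lie off the grid.
  have hy : ∀ i, g i ≠ 0 → y i ∈ Set.range q := by
    intro i hi
    refine hsupp ((Measure.mem_support_iff_forall _).2 fun U hU => ?_)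
    have h1 : 0 < (g i • Measure.dirac (y i)) U := by
      rw [Measure.smul_apply, Measure.dirac_apply_of_mem (mem_of_mem_nhds hU), ENNReal.smul_def,
        smul_eq_mul, mul_one]
      exact_mod_cast pos_iff_ne_zero.2 hi
    refine h1.trans_le ?_
    rw [Measure.finsetSum_apply]
    exact single_le_sum (f := fun i => (g i • Measure.dirac (y i)) U) (fun _ _ => zero_le)
      (mem_univ i)
  -- The `y i` may repeat, so weights at the same grid point are added.
  refine ⟨fun j => ∑ i, if y i = q j then g i else 0, ?_, ?_⟩
  · have hmaps : ∀ j ∈ {j | (∑ i, if y i = q j then g i else 0) ≠ 0},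
        q j ∈ (univ.image y : Set (Sph n)) := by
      intro j hj
      obtain ⟨i, _, hi⟩ := exists_ne_zero_of_sum_ne_zero hj
      have : y i = q j := by
        by_contra hc
        exact hi (if_neg hc)
      simpa using ⟨i, this⟩
    refine (Set.ncard_le_ncard_of_injOn q hmaps hq.injOn (finite_toSet _)).trans ?_
    rw [Set.ncard_coe_finset]
    exact card_image_le.trans (by simp)
  · simp_rw [sum_smul]
    rw [sum_comm]
    refine sum_congr rfl fun i _ => ?_
    by_cases hi : g i = 0
    · simp [hi]
    · obtain ⟨j₀, hj₀⟩ := hy i hi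
      rw [sum_eq_single j₀]
      · rw [if_pos hj₀.symm, hj₀]
      · intro j _ hj
        rw [if_neg, zero_smul]
        rw [← hj₀]
        exact fun hc => hj (hq hc).symm
      · simp

lemma moments_sum_dirac {n m N : ℕ} (f : Fin m → Sph n → ℝ) (q : Fin N → Sph n) (C : Fin N → ℝ≥0) :
    moments f (∑ j, C j • Measure.dirac (q j)) =
      gridMoments f q (WithLp.toLp 2 fun j => (C j : ℝ)) := by
  ext i
  simp only [moments, gridMoments]
  rw [integral_finsetSum_measure]
  · refine sum_congr rfl fun j _ => ?_
    rw [integral_smul_nnreal_measure, integral_dirac]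
    rfl
  · intro j _
    exact (integrable_dirac (by simp)).smul_measure_nnreal

/-- With `τ = 0` and `cν` the grid coefficients of `μ`, the error bound vanishes and `c = cν`;
nonnegativity is inherited from `μ`. -/
lemma exactRecovery_of_approxRecovery {n m N k : ℕ} {B : ℝ} {f : Fin m → Sph n → ℝ}
    {q : Fin N → Sph n} (hq : Function.Injective q) (h : ApproxRecovery k B f q) :
    ExactRecovery k f q := by
  intro μ hμ hsupp c hc
  obtain ⟨C, hC, hμC⟩ := hμ.exists_grid hq hsupp
  have hmom : moments f μ = gridMoments f q (WithLp.toLp 2 fun j => (C j : ℝ)) := by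
    rw [hμC, moments_sum_dirac]
  have hset : {z | matApply (measMatrix f q) z = moments f μ} =
      {z | ‖matApply (measMatrix f q) z - moments f μ‖ ≤ 0} := by
    ext z
    simp [sub_eq_zero]
  rw [hset] at hc
  have hsp : IsSparse k (WithLp.toLp 2 fun j => (C j : ℝ) : EuclideanSpace ℝ (Fin N)) := by
    simpa [IsSparse] using hC
  have hle := h μ hμ 0 _ hsp (by rw [hmom, sub_self, norm_zero]) c hc
  rw [mul_zero, norm_le_zero_iff, sub_eq_zero] at hle
  subst hle
  refine ⟨fun j => NNReal.coe_nonneg _, ?_⟩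
  rw [hμC]
  refine sum_congr rfl fun j _ => ?_
  simp only [ENNReal.ofReal_coe_nnreal]
  rfl

end Recovery

/-! ### The random matrix and the union bound. -/

section Main

open Finset

lemma matApply_kssFun {Ω : Type*} {n d m N : ℕ} (A : Fin m → MultiIndex n d → Ω → ℝ) (ω : Ω)
    (q : Fin N → Sph n) (v : EuclideanSpace ℝ (Fin N)) (i : Fin m) :
    matApply (measMatrix (kssFun A ω) q) v i =
      (∑ α, (∑ j, v j * ∏ l, (q j : EuclideanSpace ℝ (Fin n)) l ^ (α.1 l : ℕ)) * A i α ω) / √m := by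
  simp only [matApply, measMatrix, Matrix.mulVec, dotProduct, Matrix.of_apply, kssFun, polyEval,
    sum_mul, sum_div]
  rw [sum_comm]
  refine sum_congr rfl fun α _ => sum_congr rfl fun j _ => ?_
  ring

lemma norm_sq_matMap_kssFun {Ω : Type*} {n d m N : ℕ} (A : Fin m → MultiIndex n d → Ω → ℝ) (ω : Ω)
    (q : Fin N → Sph n) (v : EuclideanSpace ℝ (Fin N)) :
    ‖matMap (measMatrix (kssFun A ω) q) v‖ ^ 2 =
      (∑ i, (∑ α, (∑ j, v j * ∏ l, (q j : EuclideanSpace ℝ (Fin n)) l ^ (α.1 l : ℕ)) *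
        A i α ω) ^ 2) / m := by
  rw [EuclideanSpace.real_norm_sq_eq, sum_div]
  refine sum_congr rfl fun i _ => ?_
  rw [matMap_apply, matApply_kssFun, div_pow, Real.sq_sqrt (Nat.cast_nonneg m)]

/-- Concentration of the length of the image of a fixed vector under the random matrix. -/
lemma measureReal_deviation_le {Ω : Type*} [MeasurableSpace Ω] {P : Measure Ω}
    [IsProbabilityMeasure P] {n d m N : ℕ} (hm : 1 ≤ m) {A : Fin m → MultiIndex n d → Ω → ℝ}
    (hA : IsKSSSample P A) (q : Fin N → Sph n) (v : EuclideanSpace ℝ (Fin N)) {Q : ℝ}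
    (hQ : Q = ∑ i, ∑ j, v i * v j * corr d (q i) (q j)) (hQ0 : 0 < Q) {η : ℝ} (hη0 : 0 < η)
    (hη1 : η < 1) :
    P.real {ω | η * Q < |‖matMap (measMatrix (kssFun A ω) q) v‖ ^ 2 - Q|} ≤
      2 * Real.exp (-(m * c₀ η)) := by
  have hm' : (0 : ℝ) < m := by exact_mod_cast hm
  obtain ⟨hlaw, hind⟩ := rowSum_gaussian hA.law hA.indep fun α : MultiIndex n d =>
    ∑ j, v j * ∏ l, (q j : EuclideanSpace ℝ (Fin n)) l ^ (α.1 l : ℕ)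
  simp only [sum_kssVar_sq, ← hQ] at hlaw
  have hQn : Q.toNNReal ≠ 0 := (Real.toNNReal_pos.2 hQ0).ne'
  refine (measureReal_mono fun ω hω => ?_).trans
    (measureReal_sum_sq_gaussianReal_le hQn hlaw hind hη0 hη1)
  have hω' : η * Q < |‖matMap (measMatrix (kssFun A ω) q) v‖ ^ 2 - Q| := hω
  rw [norm_sq_matMap_kssFun] at hω'
  rw [Set.mem_ofPred_eq, Real.coe_toNNReal _ hQ0.le]
  have h1 := mul_lt_mul_of_pos_left hω' hm'
  rw [← abs_of_pos hm', ← abs_mul, abs_of_pos hm', mul_sub, mul_div_cancel₀ _ hm'.ne'] at h1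
  linarith

lemma sqrt_two_sub_one_bounds : 0 < √2 - 1 ∧ √2 - 1 < 1 / 2 := by
  constructor
  · rw [sub_pos, Real.lt_sqrt (by norm_num)]
    norm_num
  · rw [sub_lt_iff_lt_add, Real.sqrt_lt' (by norm_num)]
    norm_num

/-- As `2 * k ≤ N`, smaller supports extend to size exactly `2 * k`, so the union bound runs over
`N.choose (2 * k)` sets only. -/
lemma hasRIP_of_test_vectors {N k : ℕ} {F : Type} [NormedAddCommGroup F] [InnerProductSpace ℝ F]
    (hkN : 2 * k ≤ N) (L : EuclideanSpace ℝ (Fin N) →ₗ[ℝ] F)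
    (h : ∀ T : Finset (Fin N), #T = 2 * k → ∀ x : EuclideanSpace ℝ (Fin N),
      (∀ j, x j ≠ 0 → j ∈ T) → |‖L x‖ ^ 2 - ‖x‖ ^ 2| ≤ 1 / 4 * ‖x‖ ^ 2) :
    HasRIP L (2 * k) (1 / 4) := by
  classical
  intro x hx
  have hS : #(univ.filter fun j => x j ≠ 0) ≤ 2 * k := by
    have : {j | x j ≠ 0} = (univ.filter fun j => x j ≠ 0 : Finset (Fin N)) := by ext j; simp
    rwa [IsSparse, this, Set.ncard_coe_finset] at hx
  obtain ⟨T, hST, hT⟩ := exists_superset_card_eq hS (by simpa using hkN)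
  exact h T hT x fun j hj => hST (by simpa using hj)

end Main

end KSSRecovery

theorem mainTheorem6 :
    ∃ B₁ : ℝ, ∀ (n N k : ℕ) (q : Fin N → KSSRecovery.Sph n),
      Function.Injective q → 1 ≤ k → 2 * k ≤ N →
      ∃ d₀ : ℕ, ∀ d : ℕ, d₀ ≤ d → ∀ m : ℕ, 1 ≤ m →
        ∀ (Ω : Type*) [MeasurableSpace Ω] (P : Measure Ω) [IsProbabilityMeasure P]
          (A : Fin m → KSSRecovery.MultiIndex n d → Ω → ℝ), KSSRecovery.IsKSSSample P A →
          P.real {ω | ¬ (KSSRecovery.ExactRecovery k (KSSRecovery.kssFun A ω) q ∧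
              KSSRecovery.ApproxRecovery k B₁ (KSSRecovery.kssFun A ω) q)} ≤
            (N.choose (2 * k) : ℝ) * (30 / (√2 - 1)) ^ (2 * k) *
              (2 * Real.exp (-((m : ℝ) * KSSRecovery.c₀ ((√2 - 1) / 6)))) := by
  refine ⟨16, fun n N k q hq hk hkN => ?_⟩
  obtain ⟨d₀, hd₀⟩ := KSSRecovery.exists_degree_quadForm q hq (ρ := 1 / 100) (by norm_num)
  choose V hVcard hVnorm hV using KSSRecovery.exists_test_vectors (N := N)
  refine ⟨d₀, fun d hd m hm Ω _ P _ A hA => ?_⟩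
  obtain ⟨hη0, hη1⟩ := KSSRecovery.sqrt_two_sub_one_bounds
  set η : ℝ := (√2 - 1) / 6 with hη
  set Q : EuclideanSpace ℝ (Fin N) → ℝ := fun v =>
    ∑ i, ∑ j, v i * v j * KSSRecovery.corr d (q i) (q j) with hQ
  set bad : EuclideanSpace ℝ (Fin N) → Set Ω := fun v =>
    {ω | η * Q v < |‖KSSRecovery.matMap
      (KSSRecovery.measMatrix (KSSRecovery.kssFun A ω) q) v‖ ^ 2 - Q v|} with hbad
  have hdev : ∀ v, |Q v - ‖v‖ ^ 2| ≤ 1 / 100 * ‖v‖ ^ 2 := fun v => hd₀ d hd v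
  have hbadP : ∀ v, P.real (bad v) ≤ 2 * Real.exp (-((m : ℝ) * KSSRecovery.c₀ η)) := by
    intro v
    -- A net may contain 0, where the variance `Q v` degenerates.
    rcases eq_or_ne v 0 with rfl | hv
    · have : bad 0 = ∅ := by
        ext ω
        simp [hbad, hQ]
      rw [this, measureReal_empty]
      positivity
    · have hv' : 0 < ‖v‖ ^ 2 := by
        have := norm_pos_iff.2 hv
        positivity
      have := (abs_le.1 (hdev v)).1
      exact KSSRecovery.measureReal_deviation_le hm hA q v rfl (by linarith)
        (by linarith) (by linarith)
  have hsub : {ω | ¬ (KSSRecovery.ExactRecovery k (KSSRecovery.kssFun A ω) q ∧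
      KSSRecovery.ApproxRecovery k 16 (KSSRecovery.kssFun A ω) q)} ⊆
      ⋃ T ∈ Finset.powersetCard (2 * k) Finset.univ, ⋃ v ∈ V T, bad v := by
    intro ω hω
    by_contra hgood
    simp only [Set.mem_iUnion, not_exists] at hgood
    refine hω ?_
    have hrip := KSSRecovery.hasRIP_of_test_vectors hkN
      (KSSRecovery.matMap (KSSRecovery.measMatrix (KSSRecovery.kssFun A ω) q)) fun T hT x hx => by
        -- The net doubles `1/8` to `1/4`. On it the deviation is at most `η * Q v + 1/100 ≤ 1/12 *
        -- 101/100 + 1/100 < 1/8`.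
        refine (hV T _ _ (1 / 8) (fun v hv => ?_) x hx).trans_eq (by ring)
        have h1 := not_lt.1 (show ¬ η * Q v < _ from hgood T (Finset.mem_powersetCard_univ.2 hT) v hv)
        have h2 := abs_le.1 (hdev v)
        have h3 : ‖v‖ ^ 2 ≤ 1 := pow_le_one₀ (norm_nonneg _) (hVnorm T v hv)
        have h4 := abs_le.1 h1
        have h5 : η * Q v ≤ 1 / 12 * (101 / 100) :=
          mul_le_mul (by linarith) (by linarith) (by linarith [sq_nonneg ‖v‖]) (by norm_num)
        rw [abs_le]
        constructor <;> linarith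
    have happ := KSSRecovery.approxRecovery_of_hasRIP hk hkN hrip
    exact ⟨KSSRecovery.exactRecovery_of_approxRecovery hq happ, happ⟩
  have hnine : (9 : ℝ) ≤ 30 / (√2 - 1) := by
    rw [le_div_iff₀ hη0]
    linarith
  calc _ ≤ P.real (⋃ T ∈ Finset.powersetCard (2 * k) Finset.univ, ⋃ v ∈ V T, bad v) :=
        measureReal_mono hsub (measure_ne_top _ _)
    _ ≤ ∑ T ∈ Finset.powersetCard (2 * k) Finset.univ, P.real (⋃ v ∈ V T, bad v) :=
        measureReal_biUnion_finset_le _ _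
    _ ≤ ∑ T ∈ Finset.powersetCard (2 * k) (Finset.univ : Finset (Fin N)), (30 / (√2 - 1)) ^ (2 * k) *
          (2 * Real.exp (-((m : ℝ) * KSSRecovery.c₀ η))) := by
        refine Finset.sum_le_sum fun T hT => ?_
        rw [Finset.mem_powersetCard_univ] at hT
        calc _ ≤ ∑ v ∈ V T, P.real (bad v) := measureReal_biUnion_finset_le _ _
          _ ≤ ∑ v ∈ V T, 2 * Real.exp (-((m : ℝ) * KSSRecovery.c₀ η)) :=
              Finset.sum_le_sum fun v _ => hbadP v
          _ = (V T).card * (2 * Real.exp (-((m : ℝ) * KSSRecovery.c₀ η))) := by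
              rw [Finset.sum_const, nsmul_eq_mul]
          _ ≤ _ := by
              refine mul_le_mul_of_nonneg_right ?_ (by positivity)
              have h1 : ((V T).card : ℝ) ≤ 9 ^ (2 * k) := by
                have := hVcard T
                rw [hT] at this
                exact_mod_cast this
              exact h1.trans (pow_le_pow_left₀ (by norm_num) hnine _)
    _ = _ := by
        rw [Finset.sum_const, Finset.card_powersetCard, Finset.card_univ, Fintype.card_fin, nsmul_eq_mul, mul_assoc]
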